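/- Let $A\in\mathbb N^{d\times n}$ be a matrix ($d\ge 1$) whose first row is $(1,\dots,1)$ and let $\omega\in\mathbb R_{>0}^n$. Let $\Delta_{n-1}=\{p\in\mathbb R^n_{\ge0}:\sum_i p_i=1\}$, write $\operatorname{supp}(p)=\{i:p_i\neq0\}$, and let $\mathcal M=\mathcal M_{\omega,A}\subset\Delta_{n-1}$ be the toric model, that is, the Euclidean closure of the set of all $P_\theta$, $\theta\in\mathbb R^d$, where $P_\theta(x)=\frac{\omega_x}{Z_\theta}\exp\big(\sum_{i=1}^d\theta_iA_{i,x}\big)$ and $Z_\theta$ is the normalizing constant. Let $D(p\,\|\,q)=\sum_i p_i\log(p_i/q_i)$ (terms with $p_i=0$ are $0$, and $D(p\,\|\,q)=+\infty$ if $\operatorname{supp}(p)\not\subseteq\operatorname{supp}(q)$) and $D_{\mathcal M}(p)=\min_{q\in\mathcal M}D(p\,\|\,q)$ for $p\in\Delta_{n-1}$. The minimizer $q\in\mathcal M$ is called the MLE of $p$. For $q\in\mathcal M$ let $Q_q=\{p\in\Delta_{n-1}:Ap=Aq\}$. The support $\operatorname{supp}(F)$ of a face $F$ of $Q_q$ (the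 empty face is allowed) is the union of the supports of the vertices of $F$. A vertex $v$ of $Q_q$ is *complementary*, with complementary face $F$, if $F$ is a face of $Q_q$ with $\operatorname{supp}(F)=\operatorname{supp}(q)\setminus\operatorname{supp}(v)$; if $q$ has full support this means $\operatorname{supp}(F)=[n]\setminus\operatorname{supp}(v)$. A point $p\in\Delta_{n-1}$ with MLE $q$ is a *projection point* if $p_i=q_i\big/\sum_{j\in\operatorname{supp}(p)}q_j$ for all $i\in\operatorname{supp}(p)$. Then: 1. Every local maximizer $p$ of $D_{\mathcal M}$ on $\Delta_{n-1}$ is a projection point. 2. Every projection point $p$ that arises in this way, i.e. every local maximizer $p$ of $D_{\mathcal M}$, is a complementary vertex of $Q_q$, where $q$ is the MLE of $p$. 3. Let $q\in\mathcal M$ and let $v\neq q$ be a complementary vertex of $Q_q$ with complementary face $F$. Then $v$ is a projection point if and only if the line through $v$ and $q$ meets the relative interior of $F$. -/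

import Mathlib

open scoped Matrix Topology

noncomputable section

namespace ToricDivergence

variable {d n : ℕ}

/-- The matrix `A ∈ ℕ^{d × n}` with its entries read as real numbers. -/
def realMatrix (A : Matrix (Fin d) (Fin n) ℕ) : Matrix (Fin d) (Fin n) ℝ :=
  A.map (fun k : ℕ => (k : ℝ))

/-- The member `P_θ(x) = ω(x) / Z_θ * exp (∑ i, θ i * A i x)` of the exponential family. -/
def expPoint (ω : Fin n → ℝ) (A : Matrix (Fin d) (Fin n) ℕ) (θ : Fin d → ℝ) : Fin n → ℝ :=
  fun x =>
    ω x / (∑ y, ω y * Real.exp (∑ i, θ i * realMatrix A i y)) *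
      Real.exp (∑ i, θ i * realMatrix A i x)

/-- The toric model `M_{ω,A}`: the extended exponential family, i.e. the Euclidean closure of the
exponential family. -/
def toricModel (ω : Fin n → ℝ) (A : Matrix (Fin d) (Fin n) ℕ) : Set (Fin n → ℝ) :=
  closure (Set.range (expPoint ω A))

open Classical in
/-- The information divergence `D(p ‖ q) = ∑ i, p i * log (p i / q i)`, equal to `+∞` when the
support of `p` is not contained in that of `q`. Terms with `p i = 0` vanish. -/
def infoDiv (p q : Fin n → ℝ) : EReal :=
  if Function.support p ⊆ Function.support q then
    ((∑ i, p i * Real.log (p i / q i) : ℝ) : EReal)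
  else ⊤

/-- The divergence `D_M(p)` from `p` to a model `M`: the infimum of `D(p ‖ q)` over `q ∈ M`. -/
def divToModel (M : Set (Fin n → ℝ)) (p : Fin n → ℝ) : EReal :=
  ⨅ q ∈ M, infoDiv p q

/-- `q` is a maximum likelihood estimate of `p` in `M`: a point of `M` at which the minimum
defining `D_M(p)` is attained. -/
def IsMLE (M : Set (Fin n → ℝ)) (p q : Fin n → ℝ) : Prop :=
  q ∈ M ∧ infoDiv p q = divToModel M p

/-- `p` is a local maximizer of `D_M` on the probability simplex. -/
def IsLocalMaximizer (M : Set (Fin n → ℝ)) (p : Fin n → ℝ) : Prop :=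
  p ∈ stdSimplex ℝ (Fin n) ∧ IsLocalMaxOn (divToModel M) (stdSimplex ℝ (Fin n)) p

/-- The logarithmic Voronoi polytope `Q_q = {p ∈ Δ : A p = A q}`. -/
def logVoronoi (A : Matrix (Fin d) (Fin n) ℕ) (q : Fin n → ℝ) : Set (Fin n → ℝ) :=
  {p | p ∈ stdSimplex ℝ (Fin n) ∧ realMatrix A *ᵥ p = realMatrix A *ᵥ q}

/-- The support of a face: the union of the supports of its vertices. -/
def faceSupport (F : Set (Fin n → ℝ)) : Set (Fin n) :=
  ⋃ w ∈ F.extremePoints ℝ, Function.support w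

/-- `v` is a vertex of `Q_q` and `F` is a complementary face of it: a face of `Q_q` whose support
is the complement of the support of `v`. Complements are taken in the support of `q`, which is
all of `[n]` when `q` has full support; for `q` on the relative boundary of the simplex this is
the notion for the toric model on the columns of `A` indexed by the support of `q`.
Faces (`IsExposed`) are the subsets cut out by a supporting hyperplane, the polytope itself, and
the empty set. -/
def IsComplementaryPair (A : Matrix (Fin d) (Fin n) ℕ) (q v : Fin n → ℝ)
    (F : Set (Fin n → ℝ)) : Prop :=
  v ∈ (logVoronoi A q).extremePoints ℝ ∧ IsExposed ℝ (logVoronoi A q) F ∧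
    faceSupport F = Function.support q \ Function.support v

/-- `v` is a complementary vertex of `Q_q`. -/
def IsComplementaryVertex (A : Matrix (Fin d) (Fin n) ℕ) (q v : Fin n → ℝ) : Prop :=
  ∃ F : Set (Fin n → ℝ), IsComplementaryPair A q v F

/-- `p` is a projection point of the model `M`: a point of the simplex which is the renormalized
restriction of its maximum likelihood estimate `q` to its own support. (The support of `q` is
allowed to be a proper subset of `[n]`.) -/
def IsProjectionPoint (M : Set (Fin n → ℝ)) (p : Fin n → ℝ) : Prop :=
  p ∈ stdSimplex ℝ (Fin n) ∧ ∃ q : Fin n → ℝ, IsMLE M p q ∧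
    ∀ i, p i = if p i ≠ 0 then q i / (∑ j with p j ≠ 0, q j) else 0

end ToricDivergence

end

namespace ToricDivergence

variable {d n : ℕ}

/-! By Birch's theorem (`exists_mem_toricModel_mulVec_eq`) every fibre of `A` in the simplex meets
the model, and logarithms of model points are orthogonal to `ker A`. Hence `D(x‖r) - D(x‖q)` is
constant for `x` in a fibre (`relEntropy_sub_eq_relEntropy_sub`). Thus the MLE is the unique model
point of the fibre, and `D_M(x) ≥ D(x‖q) - D(y‖q)` for `y` in the fibre of `x`.

Let `p` be a local maximizer with MLE `q`. Taking `x = p + εδ` and `y = q + εδ` in this bound, where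
`D(y‖q) = O(ε²)`, gives the first order condition without differentiating `D_M` or the MLE map. With
`δ = e_i - e_j` it makes `p` proportional to `q` on `supp p`. Along directions in `ker A`, `D_M` is
`D(·‖q)`, which then exceeds its value at `p` by `D(·‖p)`; so `p` must be a vertex.

If `v ≠ q` is proportional to `q` on its support, the rest of `q`, renormalized, is a point `u` of
the line through `v` and `q` with support `supp q \ supp v` (`exists_residual`). Faces of `Q_q` are
determined by their supports (`mem_of_support_subset`), so `u` is relatively interior to the
complementary face. Conversely, a point of the line that vanishes on `supp v` forces proportionality
there. -/

/-- The real-valued relative entropy `∑ i, p i * log (p i / q i)`. -/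
noncomputable def relEntropy (p q : Fin n → ℝ) : ℝ :=
  ∑ i, p i * Real.log (p i / q i)

/-! ### Elementary estimates for relative entropy. -/

theorem infoDiv_of_support_subset {p q : Fin n → ℝ}
    (h : Function.support p ⊆ Function.support q) :
    infoDiv p q = (relEntropy p q : EReal) := by
  simp [infoDiv, relEntropy, h]

theorem infoDiv_of_not_support_subset {p q : Fin n → ℝ}
    (h : ¬ Function.support p ⊆ Function.support q) : infoDiv p q = ⊤ := by
  simp [infoDiv, h]

/-- This is `log x ≤ x - 1` at `x = b / a`; summed over coordinates it gives Gibbs' inequality. -/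
theorem sub_le_mul_log_div {a b : ℝ} (ha : 0 ≤ a) (hb : 0 ≤ b) (hab : a ≠ 0 → b ≠ 0) :
    a - b ≤ a * Real.log (a / b) := by
  rcases ha.eq_or_lt with rfl | ha
  · simpa using hb
  · have hb' : 0 < b := lt_of_le_of_ne hb (hab ha.ne').symm
    have h := Real.log_le_sub_one_of_pos (div_pos hb' ha)
    have e : Real.log (a / b) = - Real.log (b / a) := by
      rw [← Real.log_inv, inv_div]
    rw [e]
    have h2 := mul_le_mul_of_nonneg_left h ha.le
    have h3 : a * (b / a - 1) = b - a := by field_simp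
    linarith

theorem eq_of_mul_log_div_eq {a b : ℝ} (ha : 0 ≤ a) (hb : 0 ≤ b) (hab : a ≠ 0 → b ≠ 0)
    (h : a * Real.log (a / b) = a - b) : a = b := by
  rcases ha.eq_or_lt with rfl | ha
  · simp at h; exact h.symm
  · have hb' : 0 < b := lt_of_le_of_ne hb (hab ha.ne').symm
    by_contra hne
    have h1 : b / a ≠ 1 := by
      intro h; rw [div_eq_one_iff_eq ha.ne'] at h; exact hne h.symm
    have h' := Real.log_lt_sub_one_of_pos (div_pos hb' ha) h1
    have e : Real.log (a / b) = - Real.log (b / a) := by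
      rw [← Real.log_inv, inv_div]
    rw [e] at h
    have h2 := mul_lt_mul_of_pos_left h' ha
    have h3 : a * (b / a - 1) = b - a := by field_simp
    linarith

theorem relEntropy_nonneg {p q : Fin n → ℝ} (hp : p ∈ stdSimplex ℝ (Fin n))
    (hq : q ∈ stdSimplex ℝ (Fin n)) (h : Function.support p ⊆ Function.support q) :
    0 ≤ relEntropy p q := by
  have h1 : ∑ i, (p i - q i) ≤ relEntropy p q :=
    Finset.sum_le_sum fun i _ => sub_le_mul_log_div (hp.1 i) (hq.1 i) fun hi => h hi
  rw [Finset.sum_sub_distrib, hp.2, hq.2] at h1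
  linarith

theorem eq_of_relEntropy_eq_zero {p q : Fin n → ℝ} (hp : p ∈ stdSimplex ℝ (Fin n))
    (hq : q ∈ stdSimplex ℝ (Fin n)) (h : Function.support p ⊆ Function.support q)
    (h0 : relEntropy p q = 0) : p = q := by
  have h1 : ∑ i, (p i - q i) = ∑ i, p i * Real.log (p i / q i) := by
    rw [Finset.sum_sub_distrib, hp.2, hq.2]
    exact (sub_self (1 : ℝ)).trans h0.symm
  rw [Finset.sum_eq_sum_iff_of_le fun i _ =>
    sub_le_mul_log_div (hp.1 i) (hq.1 i) fun hi => h hi] at h1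
  funext i
  exact eq_of_mul_log_div_eq (hp.1 i) (hq.1 i) (fun hi => h hi) (h1 i (Finset.mem_univ i)).symm

/-- The relative entropy is bounded above by the chi-square divergence. -/
theorem relEntropy_add_smul_le {q δ : Fin n → ℝ} {ε : ℝ}
    (hδ : Function.support δ ⊆ Function.support q) (hsum : ∑ i, δ i = 0)
    (hq : ∀ i, 0 ≤ q i) (hqε : ∀ i, 0 ≤ q i + ε * δ i) :
    relEntropy (q + ε • δ) q ≤ ε ^ 2 * ∑ i, δ i ^ 2 / q i := by
  have h1 : relEntropy (q + ε • δ) q ≤ ∑ i, (ε * δ i + ε ^ 2 * (δ i ^ 2 / q i)) := by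
    refine Finset.sum_le_sum fun i _ => ?_
    simp only [Pi.add_apply, Pi.smul_apply, smul_eq_mul]
    rcases (hq i).eq_or_lt with h0 | h0
    · have : δ i = 0 := by
        by_contra hne; exact hδ hne h0.symm
      simp [← h0, this]
    · rcases (hqε i).eq_or_lt with h2 | h2
      -- Where the perturbed coordinate vanishes, both sides are zero.
      · have h3 : ε * δ i = - q i := by linarith
        have h4 : ε ^ 2 * (δ i ^ 2 / q i) = q i := by
          rw [← mul_div_assoc, ← mul_pow, h3]; field_simp
        rw [h4, ← h2, h3]; simp
      · have h3 := Real.log_le_sub_one_of_pos (div_pos h2 h0)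
        have h4 := mul_le_mul_of_nonneg_left h3 h2.le
        have h5 : (q i + ε * δ i) * ((q i + ε * δ i) / q i - 1)
            = ε * δ i + ε ^ 2 * (δ i ^ 2 / q i) := by field_simp; ring
        linarith
  rwa [Finset.sum_add_distrib, ← Finset.mul_sum, ← Finset.mul_sum, hsum, mul_zero, zero_add] at h1

/-- Changing the reference measure of a relative entropy. -/
theorem relEntropy_eq_add_sum {x q r : Fin n → ℝ}
    (hq : Function.support x ⊆ Function.support q) (hr : Function.support x ⊆ Function.support r) :
    relEntropy x r = relEntropy x q + ∑ i, x i * Real.log (q i / r i) := by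
  rw [relEntropy, relEntropy, ← Finset.sum_add_distrib]
  refine Finset.sum_congr rfl fun i _ => ?_
  by_cases hi : x i = 0
  · simp [hi]
  · have h1 : q i ≠ 0 := hq hi
    have h2 : r i ≠ 0 := hr hi
    rw [Real.log_div hi h2, Real.log_div hi h1, Real.log_div h1 h2]; ring

/-! ### Small perturbations inside the simplex. -/

theorem support_add_smul_subset {x q δ : Fin n → ℝ} {ε : ℝ}
    (hx : Function.support x ⊆ Function.support q)
    (hδ : Function.support δ ⊆ Function.support q) :
    Function.support (x + ε • δ) ⊆ Function.support q := by
  intro i hi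
  by_contra hq
  have h1 : x i = 0 := by by_contra h; exact hq (hx h)
  have h2 : δ i = 0 := by by_contra h; exact hq (hδ h)
  exact hi (by simp [h1, h2])

theorem eventually_nonneg_add_smul {x δ : Fin n → ℝ} (hx : ∀ i, 0 ≤ x i)
    (hδ : Function.support δ ⊆ Function.support x) :
    ∀ᶠ ε : ℝ in 𝓝 0, ∀ i, 0 ≤ x i + ε * δ i := by
  rw [Filter.eventually_all]
  intro i
  rcases (hx i).eq_or_lt with h0 | h0
  · have : δ i = 0 := by by_contra hne; exact hδ hne h0.symm
    simp [← h0, this]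
  · have hc : ContinuousAt (fun ε : ℝ => x i + ε * δ i) 0 := by fun_prop
    have : ∀ᶠ ε : ℝ in 𝓝 0, 0 < x i + ε * δ i :=
      hc.eventually (lt_mem_nhds (by simpa using h0))
    exact this.mono fun _ h => h.le

theorem eventually_add_smul_mem_stdSimplex {x δ : Fin n → ℝ} (hx : x ∈ stdSimplex ℝ (Fin n))
    (hδ : Function.support δ ⊆ Function.support x) (hsum : ∑ i, δ i = 0) :
    ∀ᶠ ε : ℝ in 𝓝 0, x + ε • δ ∈ stdSimplex ℝ (Fin n) := by
  filter_upwards [eventually_nonneg_add_smul hx.1 hδ] with ε h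
  refine ⟨h, ?_⟩
  simp only [Pi.add_apply, Pi.smul_apply, smul_eq_mul]
  rw [Finset.sum_add_distrib, ← Finset.mul_sum, hsum, hx.2]; simp

/-! ### The toric model -/

theorem partition_pos [Nonempty (Fin n)] {ω : Fin n → ℝ} (hω : ∀ i, 0 < ω i)
    (f : Fin n → ℝ) : 0 < ∑ y, ω y * Real.exp (f y) :=
  Finset.sum_pos (fun i _ => mul_pos (hω i) (Real.exp_pos _)) Finset.univ_nonempty

theorem expPoint_pos {ω : Fin n → ℝ} (hω : ∀ i, 0 < ω i) (A : Matrix (Fin d) (Fin n) ℕ)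
    (θ : Fin d → ℝ) (i : Fin n) : 0 < expPoint ω A θ i := by
  have : Nonempty (Fin n) := ⟨i⟩
  exact mul_pos (div_pos (hω i) (partition_pos hω _)) (Real.exp_pos _)

theorem expPoint_mem_stdSimplex [Nonempty (Fin n)] {ω : Fin n → ℝ} (hω : ∀ i, 0 < ω i)
    (A : Matrix (Fin d) (Fin n) ℕ) (θ : Fin d → ℝ) :
    expPoint ω A θ ∈ stdSimplex ℝ (Fin n) := by
  refine ⟨fun i => (expPoint_pos hω A θ i).le, ?_⟩
  have h := (partition_pos hω fun y => ∑ i, θ i * realMatrix A i y).ne'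
  simp only [expPoint, div_mul_eq_mul_div]
  rw [← Finset.sum_div, div_self h]

theorem toricModel_subset_stdSimplex [Nonempty (Fin n)] {ω : Fin n → ℝ} (hω : ∀ i, 0 < ω i)
    (A : Matrix (Fin d) (Fin n) ℕ) : toricModel ω A ⊆ stdSimplex ℝ (Fin n) :=
  closure_minimal (by rintro _ ⟨θ, rfl⟩; exact expPoint_mem_stdSimplex hω A θ)
    (isClosed_stdSimplex ℝ (Fin n))

theorem isCompact_toricModel [Nonempty (Fin n)] {ω : Fin n → ℝ} (hω : ∀ i, 0 < ω i)
    (A : Matrix (Fin d) (Fin n) ℕ) : IsCompact (toricModel ω A) :=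
  (isCompact_stdSimplex ℝ (Fin n)).of_isClosed_subset isClosed_closure
    (toricModel_subset_stdSimplex hω A)

theorem sum_eq_zero_of_mulVec_eq_zero [NeZero d] {A : Matrix (Fin d) (Fin n) ℕ}
    (hA : ∀ j, A 0 j = 1) {u : Fin n → ℝ} (hu : realMatrix A *ᵥ u = 0) : ∑ i, u i = 0 := by
  have := congrFun hu 0
  simpa [Matrix.mulVec, dotProduct, realMatrix, hA] using this

/-- The real binomial equations satisfied by the points of the toric model. -/
theorem prod_rpow_posPart_eq_prod_rpow_negPart [NeZero d] {A : Matrix (Fin d) (Fin n) ℕ}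
    (hA : ∀ j, A 0 j = 1) {ω : Fin n → ℝ} (hω : ∀ i, 0 < ω i) {q : Fin n → ℝ}
    (hq : q ∈ toricModel ω A) {u : Fin n → ℝ} (hu : realMatrix A *ᵥ u = 0) :
    ∏ i, (q i / ω i) ^ (max (u i) 0) = ∏ i, (q i / ω i) ^ (max (-u i) 0) := by
  -- Nonnegative exponents keep the real powers continuous at zero, so the identity passes from the
  -- family to its closure.
  have hcl : IsClosed {q : Fin n → ℝ |
      ∏ i, (q i / ω i) ^ (max (u i) 0) = ∏ i, (q i / ω i) ^ (max (-u i) 0)} := by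
    refine isClosed_eq ?_ ?_ <;>
    · refine continuous_finsetProd _ fun i _ => ?_
      exact (Real.continuous_rpow_const (le_max_right _ _)).comp
        ((continuous_apply i).div_const _)
  refine closure_minimal ?_ hcl hq
  rintro _ ⟨θ, rfl⟩
  rcases isEmpty_or_nonempty (Fin n) with _ | _
  · simp
  set Z := ∑ y, ω y * Real.exp (∑ i, θ i * realMatrix A i y) with hZ
  have hZ0 : 0 < Z := partition_pos hω _
  have key : ∀ x, expPoint ω A θ x / ω x
      = Real.exp (-Real.log Z + ∑ i, θ i * realMatrix A i x) := by
    intro x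
    have := (hω x).ne'
    rw [Real.exp_add, Real.exp_neg, Real.exp_log hZ0]
    simp only [expPoint, ← hZ]
    field_simp
  simp only [Set.mem_ofPred_eq, key, ← Real.exp_mul, ← Real.exp_sum]
  congr 1
  rw [← sub_eq_zero, ← Finset.sum_sub_distrib]
  have hm : ∀ x, max (u x) 0 - max (-u x) 0 = u x := fun x => by
    rcases le_total (u x) 0 with h | h
    · rw [max_eq_right h, max_eq_left (by linarith)]; ring
    · rw [max_eq_left h, max_eq_right (by linarith)]; ring
  simp only [← mul_sub, hm]
  simp only [add_mul]
  rw [Finset.sum_add_distrib, ← Finset.mul_sum, sum_eq_zero_of_mulVec_eq_zero hA hu, mul_zero,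
    zero_add]
  simp only [Finset.sum_mul]
  rw [Finset.sum_comm]
  refine Finset.sum_eq_zero fun k _ => ?_
  have := congrFun hu k
  simp only [Matrix.mulVec, dotProduct, Pi.zero_apply] at this
  simp only [mul_assoc]
  rw [← Finset.mul_sum, this, mul_zero]

/-- The support of a point of the toric model is a union of supports of fibres of `A`. -/
theorem support_subset_of_mulVec_eq [NeZero d] {A : Matrix (Fin d) (Fin n) ℕ}
    (hA : ∀ j, A 0 j = 1) {ω : Fin n → ℝ} (hω : ∀ i, 0 < ω i) {r : Fin n → ℝ}
    (hr : r ∈ toricModel ω A) {x y : Fin n → ℝ} (hy : ∀ i, 0 ≤ y i)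
    (hxy : realMatrix A *ᵥ x = realMatrix A *ᵥ y)
    (hxr : Function.support x ⊆ Function.support r) :
    Function.support y ⊆ Function.support r := by
  intro i hi hri
  have hu : realMatrix A *ᵥ (y - x) = 0 := by rw [Matrix.mulVec_sub, hxy, sub_self]
  have h := prod_rpow_posPart_eq_prod_rpow_negPart hA hω hr hu
  have hxi : x i = 0 := by
    by_contra h; exact hxr h hri
  have hyi : 0 < y i := lt_of_le_of_ne (hy i) (Ne.symm hi)
  -- The factor at `i` kills the product of positive parts, while the negative part of `y - x` lives
  -- on `supp x`, where `r` is positive.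
  rw [Finset.prod_eq_zero (Finset.mem_univ i)] at h
  · refine Finset.prod_ne_zero_iff.2 (fun j _ => ?_) h.symm
    by_cases hj : x j = 0
    · have : max (-(y - x) j) 0 = 0 := max_eq_right (by simp [hj, hy j])
      rw [this]; simp
    · have hrj : r j / ω j ≠ 0 := div_ne_zero (hxr hj) (hω j).ne'
      have : Nonempty (Fin n) := ⟨i⟩
      have h0 : 0 ≤ r j / ω j :=
        div_nonneg ((toricModel_subset_stdSimplex hω A hr).1 j) (hω j).le
      exact (Real.rpow_pos_of_pos (lt_of_le_of_ne h0 hrj.symm) _).ne'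
  · rw [hri, zero_div, Real.zero_rpow]
    simp [hxi, hyi.le, hyi.ne']

/-- Orthogonality of the logarithms of points of the toric model to the kernel of `A`. -/
theorem sum_mul_log_div_eq_zero [NeZero d] {A : Matrix (Fin d) (Fin n) ℕ}
    (hA : ∀ j, A 0 j = 1) {ω : Fin n → ℝ} (hω : ∀ i, 0 < ω i) {q : Fin n → ℝ}
    (hq : q ∈ toricModel ω A) {u : Fin n → ℝ} (hu : realMatrix A *ᵥ u = 0)
    (huq : Function.support u ⊆ Function.support q) :
    ∑ i, u i * Real.log (q i / ω i) = 0 := by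
  have h := prod_rpow_posPart_eq_prod_rpow_negPart hA hω hq hu
  have hpos : ∀ i, u i ≠ 0 → 0 < q i / ω i := fun i hi => by
    have : Nonempty (Fin n) := ⟨i⟩
    exact div_pos (lt_of_le_of_ne ((toricModel_subset_stdSimplex hω A hq).1 i)
      (Ne.symm (huq hi))) (hω i)
  have hlog : ∀ w : Fin n → ℝ, (∀ i, u i = 0 → w i = 0) →
      Real.log (∏ i, (q i / ω i) ^ w i) = ∑ i, w i * Real.log (q i / ω i) := by
    intro w hw
    rw [Real.log_prod]
    · refine Finset.sum_congr rfl fun i _ => ?_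
      by_cases hi : u i = 0
      · simp [hw i hi]
      · rw [Real.log_rpow (hpos i hi)]
    · intro i _
      by_cases hi : u i = 0
      · simp [hw i hi]
      · exact (Real.rpow_pos_of_pos (hpos i hi) _).ne'
  have h' := congrArg Real.log h
  rw [hlog (fun i => max (u i) 0) (by intro i hi; simp [hi]),
    hlog (fun i => max (-u i) 0) (by intro i hi; simp [hi]), ← sub_eq_zero,
    ← Finset.sum_sub_distrib] at h'
  rw [← h']
  refine Finset.sum_congr rfl fun i _ => ?_
  rw [← sub_mul]
  congr 1
  rcases le_total (u i) 0 with h | h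
  · rw [max_eq_right h, max_eq_left (by linarith)]; ring
  · rw [max_eq_left h, max_eq_right (by linarith)]; ring

/-- The Pythagorean identity, for two distributions in the same fibre of `A`. -/
theorem relEntropy_sub_eq_relEntropy_sub [NeZero d] {A : Matrix (Fin d) (Fin n) ℕ}
    (hA : ∀ j, A 0 j = 1) {ω : Fin n → ℝ} (hω : ∀ i, 0 < ω i) {q r : Fin n → ℝ}
    (hq : q ∈ toricModel ω A) (hr : r ∈ toricModel ω A) {x y : Fin n → ℝ}
    (hxy : realMatrix A *ᵥ x = realMatrix A *ᵥ y)
    (hxq : Function.support x ⊆ Function.support q) (hxr : Function.support x ⊆ Function.support r)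
    (hyq : Function.support y ⊆ Function.support q)
    (hyr : Function.support y ⊆ Function.support r) :
    relEntropy x r - relEntropy x q = relEntropy y r - relEntropy y q := by
  have hu : realMatrix A *ᵥ (x - y) = 0 := by rw [Matrix.mulVec_sub, hxy, sub_self]
  have hsub : ∀ {s : Fin n → ℝ}, Function.support x ⊆ Function.support s →
      Function.support y ⊆ Function.support s → Function.support (x - y) ⊆ Function.support s :=
    fun h1 h2 => (Function.support_sub x y).trans (Set.union_subset h1 h2)
  have h1 := sum_mul_log_div_eq_zero hA hω hq hu (hsub hxq hyq)
  have h2 := sum_mul_log_div_eq_zero hA hω hr hu (hsub hxr hyr)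
  have h3 : ∑ i, (x - y) i * Real.log (q i / r i) = 0 := by
    rw [← sub_zero (0 : ℝ)]
    nth_rewrite 1 [← h1]
    rw [← h2, ← Finset.sum_sub_distrib]
    refine Finset.sum_congr rfl fun i _ => ?_
    by_cases hi : (x - y) i = 0
    · simp [hi]
    · rw [Real.log_div (hsub hxq hyq hi) (hω i).ne', Real.log_div (hsub hxr hyr hi) (hω i).ne',
        Real.log_div (hsub hxq hyq hi) (hsub hxr hyr hi)]
      ring
  rw [relEntropy_eq_add_sum hxq hxr, relEntropy_eq_add_sum hyq hyr]
  simp only [Pi.sub_apply, sub_mul, Finset.sum_sub_distrib] at h3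
  linarith

/-- Exponential tilting along a row of `A` preserves the toric model. -/
theorem tilt_mem_toricModel [Nonempty (Fin n)] {A : Matrix (Fin d) (Fin n) ℕ}
    {ω : Fin n → ℝ} (hω : ∀ i, 0 < ω i) {q : Fin n → ℝ} (hq : q ∈ toricModel ω A)
    (k : Fin d) (t : ℝ) :
    (fun x => q x * Real.exp (t * realMatrix A k x) /
      ∑ y, q y * Real.exp (t * realMatrix A k y)) ∈ toricModel ω A := by
  have hqs := toricModel_subset_stdSimplex hω A hq
  have hZ : (∑ y, q y * Real.exp (t * realMatrix A k y)) ≠ 0 := by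
    obtain ⟨i, hi⟩ : ∃ i, q i ≠ 0 := by
      by_contra! h
      have := hqs.2
      simp [h] at this
    refine (Finset.sum_pos' (fun y _ => mul_nonneg (hqs.1 y) (Real.exp_pos _).le)
      ⟨i, Finset.mem_univ i, mul_pos (lt_of_le_of_ne (hqs.1 i) hi.symm) (Real.exp_pos _)⟩).ne'
  have hc : ContinuousAt (fun (p : Fin n → ℝ) x => p x * Real.exp (t * realMatrix A k x) /
      ∑ y, p y * Real.exp (t * realMatrix A k y)) q := by
    rw [continuousAt_pi]
    intro x
    refine ContinuousAt.div ((continuous_apply x).mul_const _).continuousAt (Continuous.continuousAt ?_) hZ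
    exact continuous_finsetSum _ fun y _ => (continuous_apply y).mul_const _
  -- On the family itself, tilting translates `θ` by `t` in direction `k`; continuity at `q` carries
  -- this to the closure.
  refine closure_mono ?_ (mem_closure_image hc hq)
  rintro _ ⟨_, ⟨θ, rfl⟩, rfl⟩
  refine ⟨θ + Pi.single k t, ?_⟩
  have hexp : ∀ x, ∑ i, (θ + Pi.single k t : Fin d → ℝ) i * realMatrix A i x
      = (∑ i, θ i * realMatrix A i x) + t * realMatrix A k x := by
    intro x
    simp [add_mul, Finset.sum_add_distrib, Pi.single_apply]
  funext x
  have hZ1 := (partition_pos hω fun y => ∑ i, θ i * realMatrix A i y).ne'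
  have hZ2 := (partition_pos hω
    fun y => (∑ i, θ i * realMatrix A i y) + t * realMatrix A k y).ne'
  simp only [expPoint, hexp]
  simp only [Real.exp_add] at hZ2 ⊢
  set Z := ∑ y, ω y * Real.exp (∑ i, θ i * realMatrix A i y) with hZdef
  have e : ∑ y, ω y / Z * Real.exp (∑ i, θ i * realMatrix A i y) *
      Real.exp (t * realMatrix A k y) = (∑ y, ω y * (Real.exp (∑ i, θ i * realMatrix A i y) *
      Real.exp (t * realMatrix A k y))) / Z := by
    rw [Finset.sum_div]
    exact Finset.sum_congr rfl fun y _ => by ring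
  rw [e]
  field_simp

/-- Birch's theorem: every fibre of `A` in the simplex meets the toric model. -/
theorem exists_mem_toricModel_mulVec_eq {A : Matrix (Fin d) (Fin n) ℕ}
    {ω : Fin n → ℝ} (hω : ∀ i, 0 < ω i) {p : Fin n → ℝ} (hp : p ∈ stdSimplex ℝ (Fin n)) :
    ∃ q ∈ toricModel ω A, Function.support p ⊆ Function.support q ∧
      realMatrix A *ᵥ p = realMatrix A *ᵥ q := by
  have : Nonempty (Fin n) := by
    by_contra h
    rw [not_nonempty_iff] at h
    simpa using hp.2
  -- The likelihood as a product, not its logarithm, is continuous up to the boundary.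
  have hcont : Continuous fun r : Fin n → ℝ => ∏ i, r i ^ p i :=
    continuous_finsetProd _ fun i _ =>
      (Real.continuous_rpow_const (hp.1 i)).comp (continuous_apply i)
  have h0 : expPoint ω A 0 ∈ toricModel ω A := subset_closure ⟨0, rfl⟩
  obtain ⟨q, hq, hmax⟩ := (isCompact_toricModel hω A).exists_isMaxOn ⟨_, h0⟩ hcont.continuousOn
  have hqs := toricModel_subset_stdSimplex hω A hq
  have hpos : 0 < ∏ i, q i ^ p i :=
    lt_of_lt_of_le (Finset.prod_pos fun i _ => Real.rpow_pos_of_pos (expPoint_pos hω A 0 i) _)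
      (hmax h0)
  refine ⟨q, hq, fun i hi hqi => ?_, ?_⟩
  · refine hpos.ne' (Finset.prod_eq_zero (Finset.mem_univ i) ?_)
    rw [hqi, Real.zero_rpow hi]
  funext k
  set a := realMatrix A k with ha
  have hZ : ∀ t : ℝ, 0 < ∑ y, q y * Real.exp (t * a y) := by
    intro t
    obtain ⟨i, hi⟩ : ∃ i, q i ≠ 0 := by
      by_contra! h
      have := hqs.2
      simp [h] at this
    exact Finset.sum_pos' (fun y _ => mul_nonneg (hqs.1 y) (Real.exp_pos _).le)
      ⟨i, Finset.mem_univ i, mul_pos (lt_of_le_of_ne (hqs.1 i) hi.symm) (Real.exp_pos _)⟩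
  -- Compare the maximizer with its tilts along row `k`. Equality holds at `t = 0`, so the
  -- derivatives there agree, even if `q` is a boundary point.
  have hineq : ∀ t : ℝ, Real.exp (t * ∑ i, a i * p i) ≤ ∑ y, q y * Real.exp (t * a y) := by
    intro t
    have h1 := hmax (tilt_mem_toricModel hω hq k t)
    simp only [Set.mem_ofPred_eq, ← ha] at h1
    have h2 : ∏ i, (q i * Real.exp (t * a i) / ∑ y, q y * Real.exp (t * a y)) ^ p i
        = (∏ i, q i ^ p i) * Real.exp (t * ∑ i, a i * p i) /
          ∑ y, q y * Real.exp (t * a y) := by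
      have : ∀ i, (q i * Real.exp (t * a i) / ∑ y, q y * Real.exp (t * a y)) ^ p i
          = q i ^ p i * Real.exp (t * (a i * p i)) / (∑ y, q y * Real.exp (t * a y)) ^ p i := by
        intro i
        rw [Real.div_rpow (mul_nonneg (hqs.1 i) (Real.exp_pos _).le) (hZ t).le,
          Real.mul_rpow (hqs.1 i) (Real.exp_pos _).le, ← Real.exp_mul, mul_assoc]
      simp only [this]
      rw [Finset.prod_div_distrib, Finset.prod_mul_distrib, ← Real.exp_sum, ← Finset.mul_sum,
        ← Real.rpow_sum_of_pos (hZ t), hp.2, Real.rpow_one]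
    rw [h2, div_le_iff₀ (hZ t)] at h1
    exact le_of_mul_le_mul_left h1 hpos
  set b := ∑ i, a i * p i with hb
  have hd : HasDerivAt (fun t : ℝ => (∑ y, q y * Real.exp (t * a y)) - Real.exp (t * b))
      ((∑ y, q y * a y) - b) 0 := by
    have h1 : ∀ c : ℝ, HasDerivAt (fun t : ℝ => Real.exp (t * c)) c 0 := by
      intro c
      simpa using ((hasDerivAt_id (0 : ℝ)).mul_const c).exp
    exact (HasDerivAt.fun_sum fun y _ => (h1 (a y)).const_mul (q y)).sub (h1 b)
  have hmin : IsLocalMin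
      (fun t : ℝ => (∑ y, q y * Real.exp (t * a y)) - Real.exp (t * b)) 0 := by
    refine Filter.Eventually.of_forall fun t => ?_
    have := hineq t
    simp [hqs.2]
    linarith
  have hz := hmin.hasDerivAt_eq_zero hd
  change ∑ i, a i * p i = ∑ i, a i * q i
  rw [← hb]
  simp only [mul_comm (a _) (q _)]
  linarith

theorem relEntropy_self (q : Fin n → ℝ) : relEntropy q q = 0 := by
  refine Finset.sum_eq_zero fun i _ => ?_
  by_cases h : q i = 0
  · simp [h]
  · simp [div_self h]

theorem nonempty_of_mem_stdSimplex {p : Fin n → ℝ} (hp : p ∈ stdSimplex ℝ (Fin n)) :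
    Nonempty (Fin n) := by
  by_contra h
  rw [not_nonempty_iff] at h
  simpa using hp.2

/-! ### Maximum likelihood estimates -/

theorem exists_mem_logVoronoi (A : Matrix (Fin d) (Fin n) ℕ) {ω : Fin n → ℝ} (hω : ∀ i, 0 < ω i)
    {p : Fin n → ℝ} (hp : p ∈ stdSimplex ℝ (Fin n)) :
    ∃ q ∈ toricModel ω A, p ∈ logVoronoi A q := by
  obtain ⟨q, hq, -, h⟩ := exists_mem_toricModel_mulVec_eq (A := A) hω hp
  exact ⟨q, hq, hp, h⟩

section MLE

variable [NeZero d] {A : Matrix (Fin d) (Fin n) ℕ} {ω : Fin n → ℝ}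

theorem support_subset_of_mem_logVoronoi (hA : ∀ j, A 0 j = 1) (hω : ∀ i, 0 < ω i)
    {p q : Fin n → ℝ} (hq : q ∈ toricModel ω A) (hp : p ∈ logVoronoi A q) :
    Function.support p ⊆ Function.support q :=
  support_subset_of_mulVec_eq hA hω hq hp.1.1 hp.2.symm subset_rfl

/-- A lower bound for the divergence from the toric model. -/
theorem relEntropy_sub_le_divToModel (hA : ∀ j, A 0 j = 1) (hω : ∀ i, 0 < ω i)
    {q x y : Fin n → ℝ} (hq : q ∈ toricModel ω A) (hy : y ∈ stdSimplex ℝ (Fin n))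
    (hxy : realMatrix A *ᵥ x = realMatrix A *ᵥ y)
    (hxq : Function.support x ⊆ Function.support q)
    (hyq : Function.support y ⊆ Function.support q) :
    ((relEntropy x q - relEntropy y q : ℝ) : EReal) ≤ divToModel (toricModel ω A) x := by
  have := nonempty_of_mem_stdSimplex hy
  refine le_iInf₂ fun r hr => ?_
  by_cases hxr : Function.support x ⊆ Function.support r
  · have hyr := support_subset_of_mulVec_eq hA hω hr hy.1 hxy hxr
    rw [infoDiv_of_support_subset hxr, EReal.coe_le_coe_iff]
    -- Exchange `x` for `y` by the Pythagorean identity, then drop `D(y‖r) ≥ 0`.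
    have h1 := relEntropy_sub_eq_relEntropy_sub hA hω hq hr hxy hxq hxr hyq hyr
    have h2 := relEntropy_nonneg hy (toricModel_subset_stdSimplex hω A hr) hyr
    linarith
  · rw [infoDiv_of_not_support_subset hxr]
    exact le_top

/-- The point `q` is itself a competitor, and the lower bound with `y = q` is sharp. -/
theorem divToModel_eq_relEntropy (hA : ∀ j, A 0 j = 1) (hω : ∀ i, 0 < ω i)
    {p q : Fin n → ℝ} (hq : q ∈ toricModel ω A) (hp : p ∈ logVoronoi A q) :
    divToModel (toricModel ω A) p = (relEntropy p q : EReal) := by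
  have := nonempty_of_mem_stdSimplex hp.1
  have hpq := support_subset_of_mem_logVoronoi hA hω hq hp
  refine le_antisymm ?_ ?_
  · rw [← infoDiv_of_support_subset hpq]
    exact iInf₂_le q hq
  · have h := relEntropy_sub_le_divToModel hA hω hq (toricModel_subset_stdSimplex hω A hq) hp.2
      hpq subset_rfl
    rwa [relEntropy_self, sub_zero] at h

theorem isMLE_of_mem_logVoronoi (hA : ∀ j, A 0 j = 1) (hω : ∀ i, 0 < ω i)
    {p q : Fin n → ℝ} (hq : q ∈ toricModel ω A) (hp : p ∈ logVoronoi A q) :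
    IsMLE (toricModel ω A) p q :=
  ⟨hq, by rw [divToModel_eq_relEntropy hA hω hq hp,
    infoDiv_of_support_subset (support_subset_of_mem_logVoronoi hA hω hq hp)]⟩

/-- The maximum likelihood estimate is unique. -/
theorem IsMLE.eq_of_mem_logVoronoi (hA : ∀ j, A 0 j = 1) (hω : ∀ i, 0 < ω i)
    {p q r : Fin n → ℝ} (hq : q ∈ toricModel ω A) (hp : p ∈ logVoronoi A q)
    (hr : IsMLE (toricModel ω A) p r) : r = q := by
  have := nonempty_of_mem_stdSimplex hp.1
  have hqs := toricModel_subset_stdSimplex hω A hq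
  have hpq := support_subset_of_mem_logVoronoi hA hω hq hp
  have h := hr.2
  rw [divToModel_eq_relEntropy hA hω hq hp] at h
  have hpr : Function.support p ⊆ Function.support r := by
    by_contra hn
    rw [infoDiv_of_not_support_subset hn] at h
    exact EReal.coe_ne_top _ h.symm
  rw [infoDiv_of_support_subset hpr, EReal.coe_eq_coe_iff] at h
  have hqr := support_subset_of_mulVec_eq hA hω hr.1 hqs.1 hp.2 hpr
  have h1 := relEntropy_sub_eq_relEntropy_sub hA hω hq hr.1 hp.2 hpq hpr subset_rfl hqr
  rw [relEntropy_self] at h1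
  exact (eq_of_relEntropy_eq_zero hqs (toricModel_subset_stdSimplex hω A hr.1) hqr
    (by linarith)).symm

theorem IsMLE.mem_logVoronoi (hA : ∀ j, A 0 j = 1) (hω : ∀ i, 0 < ω i)
    {p q : Fin n → ℝ} (hp : p ∈ stdSimplex ℝ (Fin n)) (hq : IsMLE (toricModel ω A) p q) :
    p ∈ logVoronoi A q := by
  obtain ⟨r, hr, hpr⟩ := exists_mem_logVoronoi A hω hp
  rwa [hq.eq_of_mem_logVoronoi hA hω hr hpr]

/-! ### Local maximizers are projection points -/

theorem IsLocalMaximizer.eventually_le {M : Set (Fin n → ℝ)} {p : Fin n → ℝ}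
    (hp : IsLocalMaximizer M p) {δ : Fin n → ℝ} (hδ : Function.support δ ⊆ Function.support p)
    (hsum : ∑ i, δ i = 0) :
    ∀ᶠ ε : ℝ in 𝓝 0, p + ε • δ ∈ stdSimplex ℝ (Fin n) ∧
      divToModel M (p + ε • δ) ≤ divToModel M p := by
  have h1 := eventually_add_smul_mem_stdSimplex hp.1 hδ hsum
  have hc : Filter.Tendsto (fun ε : ℝ => p + ε • δ) (𝓝 0) (𝓝 p) := by
    have : Continuous fun ε : ℝ => p + ε • δ := by fun_prop
    simpa using this.tendsto 0
  filter_upwards [h1, hc.eventually (eventually_nhdsWithin_iff.1 hp.2)] with ε h2 h3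
  exact ⟨h2, h3 h2⟩

/-- Both signs of `ε` are allowed, so `εL - ε²C` has a two-sided local maximum at zero, with
derivative `L`. -/
theorem eq_zero_of_eventually_mul_le {L C : ℝ}
    (h : ∀ᶠ ε : ℝ in 𝓝 0, ε * L ≤ ε ^ 2 * C) : L = 0 := by
  have hmax : IsLocalMax (fun ε : ℝ => ε * L - ε ^ 2 * C) 0 := by
    filter_upwards [h] with ε hε
    simpa using hε
  have hd : HasDerivAt (fun ε : ℝ => ε * L - ε ^ 2 * C) L 0 := by
    have := ((hasDerivAt_id' (0 : ℝ)).mul_const L).fun_sub ((hasDerivAt_pow 2 (0 : ℝ)).mul_const C)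
    simpa using this
  exact hmax.hasDerivAt_eq_zero hd

/-- The first order condition at a local maximizer. -/
theorem IsLocalMaximizer.sum_mul_log_div_eq_zero (hA : ∀ j, A 0 j = 1) (hω : ∀ i, 0 < ω i)
    {p q : Fin n → ℝ} (hp : IsLocalMaximizer (toricModel ω A) p) (hq : q ∈ toricModel ω A)
    (hpq : p ∈ logVoronoi A q) {δ : Fin n → ℝ}
    (hδ : Function.support δ ⊆ Function.support p) (hsum : ∑ i, δ i = 0) :
    ∑ i, δ i * Real.log (p i / q i) = 0 := by
  have := nonempty_of_mem_stdSimplex hp.1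
  have hqs := toricModel_subset_stdSimplex hω A hq
  have hs := support_subset_of_mem_logVoronoi hA hω hq hpq
  refine eq_zero_of_eventually_mul_le (C := ∑ i, δ i ^ 2 / q i) ?_
  filter_upwards [hp.eventually_le hδ hsum,
    eventually_add_smul_mem_stdSimplex hqs (hδ.trans hs) hsum] with ε h1 h2
  have hx : Function.support (p + ε • δ) ⊆ Function.support p :=
    support_add_smul_subset subset_rfl hδ
  have hy : Function.support (q + ε • δ) ⊆ Function.support q :=
    support_add_smul_subset subset_rfl (hδ.trans hs)
  -- Since `Ap = Aq`, the points `p + εδ` and `q + εδ` lie in one fibre.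
  have h3 := (relEntropy_sub_le_divToModel (x := p + ε • δ) hA hω hq h2
    (by rw [Matrix.mulVec_add, Matrix.mulVec_add, hpq.2]) (hx.trans hs) hy).trans h1.2
  rw [divToModel_eq_relEntropy hA hω hq hpq, EReal.coe_le_coe_iff] at h3
  have h4 := relEntropy_add_smul_le (hδ.trans hs) hsum hqs.1 h2.1
  have h5 := relEntropy_eq_add_sum hx (hx.trans hs)
  have h6 := relEntropy_nonneg h1.1 hp.1 hx
  have h7 : ∑ i, (p + ε • δ) i * Real.log (p i / q i)
      = relEntropy p q + ε * ∑ i, δ i * Real.log (p i / q i) := by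
    simp only [relEntropy, Finset.mul_sum, ← Finset.sum_add_distrib, Pi.add_apply, Pi.smul_apply,
      smul_eq_mul]
    exact Finset.sum_congr rfl fun i _ => by ring
  linarith

/-- A local maximizer is proportional on its support to its maximum likelihood estimate. -/
theorem IsLocalMaximizer.eq_div_sum (hA : ∀ j, A 0 j = 1) (hω : ∀ i, 0 < ω i)
    {p q : Fin n → ℝ} (hp : IsLocalMaximizer (toricModel ω A) p) (hq : q ∈ toricModel ω A)
    (hpq : p ∈ logVoronoi A q) :
    ∀ i, p i = if p i ≠ 0 then q i / (∑ j with p j ≠ 0, q j) else 0 := by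
  have := nonempty_of_mem_stdSimplex hp.1
  have hqs := toricModel_subset_stdSimplex hω A hq
  have hs := support_subset_of_mem_logVoronoi hA hω hq hpq
  have hp0 : ∀ i, p i ≠ 0 → 0 < p i := fun i hi => lt_of_le_of_ne (hp.1.1 i) hi.symm
  have hq0 : ∀ i, p i ≠ 0 → 0 < q i := fun i hi => lt_of_le_of_ne (hqs.1 i) (Ne.symm (hs hi))
  intro i
  split_ifs with hi
  swap
  · simpa using hi
  have hratio : ∀ j, p j ≠ 0 → q j = q i / p i * p j := by
    intro j hj
    -- The direction `e_i - e_j` equates the ratios `p / q` at `i` and `j`.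
    have h := hp.sum_mul_log_div_eq_zero hA hω hq hpq
      (δ := Pi.single i 1 - Pi.single j 1) (by
        intro k hk
        by_contra hpk
        have h1 : k ≠ i := by rintro rfl; exact hpk hi
        have h2 : k ≠ j := by rintro rfl; exact hpk hj
        exact hk (by simp [h1, h2])) (by simp)
    simp only [Pi.sub_apply, sub_mul, Finset.sum_sub_distrib, Pi.single_apply, ite_mul, one_mul,
      zero_mul, Finset.sum_ite_eq', Finset.mem_univ, if_true, sub_eq_zero] at h
    have h' := Real.log_injOn_pos (div_pos (hp0 i hi) (hq0 i hi)) (div_pos (hp0 j hj) (hq0 j hj)) h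
    have := (hq0 i hi).ne'
    have := (hq0 j hj).ne'
    field_simp at h' ⊢
    linarith
  have hsum : ∑ j with p j ≠ 0, q j = q i / p i := by
    rw [Finset.sum_congr rfl fun j hj => hratio j (Finset.mem_filter.1 hj).2, ← Finset.mul_sum,
      Finset.sum_filter_ne_zero, hp.1.2, mul_one]
  rw [hsum]
  have := (hq0 i hi).ne'
  field_simp

theorem IsLocalMaximizer.isProjectionPoint (hA : ∀ j, A 0 j = 1) (hω : ∀ i, 0 < ω i)
    {p : Fin n → ℝ} (hp : IsLocalMaximizer (toricModel ω A) p) :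
    IsProjectionPoint (toricModel ω A) p := by
  obtain ⟨q, hq, hpq⟩ := exists_mem_logVoronoi A hω hp.1
  exact ⟨hp.1, q, isMLE_of_mem_logVoronoi hA hω hq hpq, hp.eq_div_sum hA hω hq hpq⟩

/-- A local maximizer is a vertex of its logarithmic Voronoi polytope. -/
theorem IsLocalMaximizer.mem_extremePoints (hA : ∀ j, A 0 j = 1) (hω : ∀ i, 0 < ω i)
    {p q : Fin n → ℝ} (hp : IsLocalMaximizer (toricModel ω A) p) (hq : q ∈ toricModel ω A)
    (hpq : p ∈ logVoronoi A q) : p ∈ (logVoronoi A q).extremePoints ℝ := by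
  have hs := support_subset_of_mem_logVoronoi hA hω hq hpq
  rw [_root_.mem_extremePoints]
  refine ⟨hpq, fun x hx y hy hxy => ?_⟩
  suffices hxy' : x = y by
    subst hxy'
    simp only [openSegment_same, Set.mem_singleton_iff] at hxy
    exact ⟨hxy.symm, hxy.symm⟩
  obtain ⟨a, b, ha, hb, hab, he⟩ := hxy
  have hsupp : ∀ i, p i = 0 → x i = 0 ∧ y i = 0 := by
    intro i hi
    have h := congrFun he i
    simp only [Pi.add_apply, Pi.smul_apply, smul_eq_mul, hi] at h
    have h1 := mul_nonneg ha.le (hx.1.1 i)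
    have h2 := mul_nonneg hb.le (hy.1.1 i)
    constructor
    · exact (mul_eq_zero.1 (by linarith : a * x i = 0)).resolve_left ha.ne'
    · exact (mul_eq_zero.1 (by linarith : b * y i = 0)).resolve_left hb.ne'
  have hδ : Function.support (x - y) ⊆ Function.support p := by
    intro i hi hpi
    exact hi (by simp [hsupp i hpi])
  have hsum : ∑ i, (x - y) i = 0 := by
    simp [hx.1.2, hy.1.2]
  have hev := hp.eventually_le hδ hsum
  obtain ⟨ε, h1, hε⟩ := ((hev.filter_mono nhdsWithin_le_nhds).and
    (self_mem_nhdsWithin (s := {(0 : ℝ)}ᶜ))).exists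
  have hx' : Function.support (p + ε • (x - y)) ⊆ Function.support p :=
    support_add_smul_subset subset_rfl hδ
  have hmem : p + ε • (x - y) ∈ logVoronoi A q := by
    refine ⟨h1.1, ?_⟩
    rw [Matrix.mulVec_add, Matrix.mulVec_smul, Matrix.mulVec_sub, hx.2, hy.2, hpq.2]
    simp
  have h2 := h1.2
  rw [divToModel_eq_relEntropy hA hω hq hmem, divToModel_eq_relEntropy hA hω hq hpq,
    EReal.coe_le_coe_iff] at h2
  have h5 := relEntropy_eq_add_sum hx' (hx'.trans hs)
  -- The linear term vanishes, so `D_M` grows by exactly `D(p + ε(x - y)‖p)`, which maximality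
  -- forces to be zero.
  have h7 : ∑ i, (p + ε • (x - y)) i * Real.log (p i / q i) = relEntropy p q := by
    have h := hp.sum_mul_log_div_eq_zero hA hω hq hpq hδ hsum
    have : ∑ i, (p + ε • (x - y)) i * Real.log (p i / q i)
        = relEntropy p q + ε * ∑ i, (x - y) i * Real.log (p i / q i) := by
      simp only [relEntropy, Finset.mul_sum, ← Finset.sum_add_distrib, Pi.add_apply,
        Pi.smul_apply, smul_eq_mul]
      exact Finset.sum_congr rfl fun i _ => by ring
    rw [this, h, mul_zero, add_zero]
  have h8 := eq_of_relEntropy_eq_zero h1.1 hp.1 hx'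
    (le_antisymm (by linarith) (relEntropy_nonneg h1.1 hp.1 hx'))
  have h9 : ε • (x - y) = 0 := by simpa using h8
  exact sub_eq_zero.1 ((smul_eq_zero.1 h9).resolve_left hε)

end MLE

/-! ### Faces of the logarithmic Voronoi polytope -/

theorem convex_logVoronoi (A : Matrix (Fin d) (Fin n) ℕ) (q : Fin n → ℝ) :
    Convex ℝ (logVoronoi A q) := by
  intro x hx y hy a b ha hb hab
  refine ⟨convex_stdSimplex ℝ (Fin n) hx.1 hy.1 ha hb hab, ?_⟩
  rw [Matrix.mulVec_add, Matrix.mulVec_smul, Matrix.mulVec_smul, hx.2, hy.2, ← add_smul, hab,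
    one_smul]

theorem isCompact_logVoronoi (A : Matrix (Fin d) (Fin n) ℕ) (q : Fin n → ℝ) :
    IsCompact (logVoronoi A q) := by
  refine (isCompact_stdSimplex ℝ (Fin n)).inter_right (t := {p | _ = _}) ?_
  exact isClosed_eq (Continuous.matrix_mulVec continuous_const continuous_id) continuous_const

/-- By Krein–Milman, if all vertices lie in the closed convex set `x_i = 0`, so does `F`. -/
theorem support_subset_faceSupport {F : Set (Fin n → ℝ)} (hF : IsCompact F) (hconv : Convex ℝ F)
    {x : Fin n → ℝ} (hx : x ∈ F) : Function.support x ⊆ faceSupport F := by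
  intro i hi
  by_contra h
  have h0 : F.extremePoints ℝ ⊆ {w | w i = 0} := by
    intro w hw
    by_contra hwi
    exact h (Set.mem_biUnion hw hwi)
  have hK := closure_convexHull_extremePoints hF hconv
  have hcl : IsClosed {w : Fin n → ℝ | w i = 0} :=
    isClosed_eq (continuous_apply i) continuous_const
  have hcv : Convex ℝ {w : Fin n → ℝ | w i = 0} := by
    intro x hx y hy a b _ _ _
    simp only [Set.mem_ofPred_eq] at hx hy ⊢
    simp [hx, hy]
  rw [← hK] at hx
  exact hi (closure_minimal (convexHull_min h0 hcv) hcl hx)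

/-- A nonempty face contains a point whose support is the support of the face. -/
theorem exists_mem_support_eq_faceSupport {F : Set (Fin n → ℝ)} (hF : IsCompact F)
    (hconv : Convex ℝ F) (hne : F.Nonempty) (hpos : ∀ x ∈ F, ∀ i, 0 ≤ x i) :
    ∃ w ∈ F, Function.support w = faceSupport F := by
  classical
  obtain ⟨x₀, hx₀⟩ := hne
  suffices H : ∀ s : Finset (Fin n), (s : Set (Fin n)) ⊆ faceSupport F →
      ∃ w ∈ F, (s : Set (Fin n)) ⊆ Function.support w by
    obtain ⟨w, hw, h⟩ := H (faceSupport F).toFinset (by simp)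
    exact ⟨w, hw, (support_subset_faceSupport hF hconv hw).antisymm (by simpa using h)⟩
  intro s
  induction s using Finset.induction_on with
  | empty => intro _; exact ⟨x₀, hx₀, by simp⟩
  | insert i s _ ih =>
    intro hs
    rw [Finset.coe_insert, Set.insert_subset_iff] at hs
    obtain ⟨w, hw, hsw⟩ := ih hs.2
    obtain ⟨z, hz, hzi⟩ := Set.mem_iUnion₂.1 hs.1
    have hzF := extremePoints_subset hz
    -- Coordinates are nonnegative, so the midpoint has the union of the two supports.
    refine ⟨(1 / 2 : ℝ) • w + (1 / 2 : ℝ) • z,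
      hconv hw hzF (by norm_num) (by norm_num) (by norm_num), ?_⟩
    have key : ∀ j, w j ≠ 0 ∨ z j ≠ 0 → ((1 / 2 : ℝ) • w + (1 / 2 : ℝ) • z) j ≠ 0 := by
      intro j hj
      have h1 := hpos w hw j
      have h2 := hpos z hzF j
      simp only [Pi.add_apply, Pi.smul_apply, smul_eq_mul]
      rcases hj with hj | hj
      · have := lt_of_le_of_ne h1 hj.symm
        positivity
      · have := lt_of_le_of_ne h2 hj.symm
        positivity
    rw [Finset.coe_insert, Set.insert_subset_iff]
    exact ⟨key i (Or.inr hzi), fun j hj => key j (Or.inl (hsw hj))⟩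

/-- The segment from `u` to `w` extends slightly past `w` inside the polytope, so a functional
maximal at `w` cannot be smaller at `u`. -/
theorem mem_of_support_subset {A : Matrix (Fin d) (Fin n) ℕ} {q : Fin n → ℝ}
    {F : Set (Fin n → ℝ)} (hF : IsExposed ℝ (logVoronoi A q) F) {w u : Fin n → ℝ} (hw : w ∈ F)
    (hu : u ∈ logVoronoi A q) (huw : Function.support u ⊆ Function.support w) : u ∈ F := by
  obtain ⟨l, hl⟩ := hF ⟨w, hw⟩
  have hw' := hw
  rw [hl] at hw' ⊢
  refine ⟨hu, fun y hy => (hw'.2 y hy).trans ?_⟩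
  have hδ : Function.support (w - u) ⊆ Function.support w :=
    (Function.support_sub w u).trans (Set.union_subset subset_rfl huw)
  have hev := eventually_add_smul_mem_stdSimplex hw'.1.1 hδ
    (by simp [hw'.1.1.2, hu.1.2])
  obtain ⟨ε, h1, hε⟩ := ((hev.filter_mono nhdsWithin_le_nhds).and
    (self_mem_nhdsWithin (s := Set.Ioi (0 : ℝ)))).exists
  have hmem : w + ε • (w - u) ∈ logVoronoi A q := by
    refine ⟨h1, ?_⟩
    rw [Matrix.mulVec_add, Matrix.mulVec_smul, Matrix.mulVec_sub, hu.2, hw'.1.2]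
    simp
  have h2 := hw'.2 _ hmem
  simp only [map_add, map_smul, map_sub, smul_eq_mul] at h2
  have h3 : ε * (l w - l u) ≤ 0 := by linarith
  have h4 := nonpos_of_mul_nonpos_right h3 hε
  linarith

/-- A point of a face with full support lies in its relative interior. -/
theorem mem_intrinsicInterior_of_support_eq {A : Matrix (Fin d) (Fin n) ℕ} {q : Fin n → ℝ}
    {F : Set (Fin n → ℝ)} (hF : IsExposed ℝ (logVoronoi A q) F) {u : Fin n → ℝ} (hu : u ∈ F)
    (hs : ∀ x ∈ F, Function.support x ⊆ Function.support u) : u ∈ intrinsicInterior ℝ F := by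
  have hsub : F ⊆ logVoronoi A q := hF.subset
  refine ⟨⟨u, subset_affineSpan ℝ F hu⟩, ?_, rfl⟩
  rw [mem_interior_iff_mem_nhds]
  -- Support containment and the linear equations extend to the affine span. Near `u` positivity on
  -- `supp u` persists, which puts the point in `Q_q` and hence in `F`.
  have hspan : ∀ x ∈ affineSpan ℝ F, (Function.support x ⊆ Function.support u) ∧
      (∑ i, x i = 1) ∧ realMatrix A *ᵥ x = realMatrix A *ᵥ q := by
    intro x hx
    refine affineSpan_induction hx (fun x hx => ⟨hs x hx, (hsub hx).1.2, (hsub hx).2⟩) ?_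
    intro c x y z hx hy hz
    simp only [vsub_eq_sub, vadd_eq_add]
    refine ⟨?_, ?_, ?_⟩
    · rw [add_comm]
      exact support_add_smul_subset hz.1
        ((Function.support_sub x y).trans (Set.union_subset hx.1 hy.1))
    · simp [Finset.sum_add_distrib, ← Finset.mul_sum, hx.2.1, hy.2.1, hz.2.1]
    · rw [Matrix.mulVec_add, Matrix.mulVec_smul, Matrix.mulVec_sub, hx.2.2, hy.2.2, hz.2.2]
      simp
  have hev : ∀ᶠ x : affineSpan ℝ F in 𝓝 ⟨u, subset_affineSpan ℝ F hu⟩,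
      ∀ i, u i ≠ 0 → 0 < (x : Fin n → ℝ) i := by
    rw [Filter.eventually_all]
    intro i
    by_cases hi : u i = 0
    · simp [hi]
    have hc : Continuous fun x : affineSpan ℝ F => (x : Fin n → ℝ) i :=
      (continuous_apply i).comp continuous_subtype_val
    have hui : 0 < u i := lt_of_le_of_ne ((hsub hu).1.1 i) (Ne.symm hi)
    exact (hc.continuousAt.eventually (lt_mem_nhds hui)).mono fun _ h _ => h
  filter_upwards [hev] with x hx
  have hx' := hspan x x.2
  refine mem_of_support_subset hF hu ⟨⟨fun i => ?_, hx'.2.1⟩, hx'.2.2⟩ hx'.1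
  by_cases hi : u i = 0
  · have : (x : Fin n → ℝ) i = 0 := by
      by_contra h; exact hx'.1 h hi
    exact this.ge
  · exact (hx i hi).le

/-- The point where the line from `v` through `q` leaves the simplex, for `v` proportional to `q`
on its support. -/
theorem exists_residual {A : Matrix (Fin d) (Fin n) ℕ} {q v : Fin n → ℝ}
    (hq : q ∈ stdSimplex ℝ (Fin n)) (hv : v ∈ logVoronoi A q)
    (hne : v ≠ q)
    (hproj : ∀ i, v i = if v i ≠ 0 then q i / (∑ j with v j ≠ 0, q j) else 0) :
    ∃ u ∈ logVoronoi A q, u ∈ line[ℝ, v, q] ∧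
      Function.support u = Function.support q \ Function.support v := by
  set s := ∑ j with v j ≠ 0, q j with hs
  have hcompl : s + ∑ j with ¬ v j ≠ 0, q j = 1 := by
    rw [hs, Finset.sum_filter_add_sum_filter_not, hq.2]
  have hs0 : s ≠ 0 := by
    intro h0
    have : v = 0 := by
      funext i
      rw [hproj i, h0]; simp
    have h1 := hv.1.2
    simp [this] at h1
  have hnn : 0 ≤ ∑ j with ¬ v j ≠ 0, q j := Finset.sum_nonneg fun j _ => hq.1 j
  have hs1 : s < 1 := by
    rcases hnn.lt_or_eq with h | h
    · linarith
    · exfalso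
      have hs1 : s = 1 := by linarith
      have h2 := (Finset.sum_eq_zero_iff_of_nonneg fun j _ => hq.1 j).1 h.symm
      apply hne
      funext i
      by_cases hi : v i = 0
      · rw [hi, h2 i (by simp [hi])]
      · rw [hproj i, if_pos hi, hs1, div_one]
  -- The parameter `1 / (1 - s)` comes from solving `q = s v + (1 - s) u` for `u`.
  have h1s : (1 - s) ≠ 0 := by linarith
  have hu : ∀ i, (AffineMap.lineMap v q (1 / (1 - s)) : Fin n → ℝ) i
      = if v i = 0 then q i / (1 - s) else 0 := by
    intro i
    simp only [AffineMap.lineMap_apply, vsub_eq_sub, vadd_eq_add, Pi.add_apply, Pi.smul_apply,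
      Pi.sub_apply, smul_eq_mul]
    split_ifs with hi
    · rw [hi]; ring
    · have : v i * s = q i := by
        rw [hproj i, if_pos hi]; field_simp
      rw [← this]; field_simp; ring
  refine ⟨AffineMap.lineMap v q (1 / (1 - s)), ⟨⟨fun i => ?_, ?_⟩, ?_⟩,
    AffineMap.lineMap_mem_affineSpan_pair _ _ _, ?_⟩
  · rw [hu i]
    split_ifs
    · exact div_nonneg (hq.1 i) (by linarith)
    · exact le_rfl
  · simp only [AffineMap.lineMap_apply, vsub_eq_sub, vadd_eq_add, Pi.add_apply, Pi.smul_apply,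
      Pi.sub_apply, smul_eq_mul]
    rw [Finset.sum_add_distrib, ← Finset.mul_sum, Finset.sum_sub_distrib, hq.2, hv.1.2]
    simp
  · simp only [AffineMap.lineMap_apply, vsub_eq_sub, vadd_eq_add]
    rw [Matrix.mulVec_add, Matrix.mulVec_smul, Matrix.mulVec_sub, hv.2]
    simp
  · ext i
    simp only [Function.mem_support, hu i, Set.mem_sdiff, ne_eq, not_not]
    by_cases hi : v i = 0 <;> simp [hi, h1s]

/-- The points of the logarithmic Voronoi polytope vanishing on the support of `p` form a face. -/
theorem isExposed_disjoint_support (A : Matrix (Fin d) (Fin n) ℕ) (q p : Fin n → ℝ) :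
    IsExposed ℝ (logVoronoi A q) {x ∈ logVoronoi A q | ∀ i, p i ≠ 0 → x i = 0} := by
  -- Exposedness is only asked of nonempty sets; `x₀` shows that the functional attains its upper
  -- bound zero.
  rintro ⟨x₀, hx₀, hz⟩
  refine ⟨-∑ i with p i ≠ 0, ContinuousLinearMap.proj (R := ℝ) (φ := fun _ : Fin n => ℝ) i, ?_⟩
  have happ : ∀ x : Fin n → ℝ,
      (-∑ i with p i ≠ 0, ContinuousLinearMap.proj (R := ℝ) (φ := fun _ : Fin n => ℝ) i) x
        = -∑ i with p i ≠ 0, x i := by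
    intro x
    simp
  ext x
  simp only [Set.mem_ofPred_eq, happ, neg_le_neg_iff]
  refine and_congr_right fun hx => ⟨fun h y hy => ?_, fun h i hi => ?_⟩
  · rw [Finset.sum_eq_zero fun i hi => h i (Finset.mem_filter.1 hi).2]
    exact Finset.sum_nonneg fun i _ => hy.1.1 i
  · have h0 := h x₀ hx₀
    rw [Finset.sum_eq_zero fun i hi => hz i (Finset.mem_filter.1 hi).2] at h0
    exact (Finset.sum_eq_zero_iff_of_nonneg fun j _ => hx.1.1 j).1
      (h0.antisymm (Finset.sum_nonneg fun j _ => hx.1.1 j)) i (by simpa using hi)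

theorem isCompact_of_isExposed {A : Matrix (Fin d) (Fin n) ℕ} {q : Fin n → ℝ}
    {F : Set (Fin n → ℝ)} (hF : IsExposed ℝ (logVoronoi A q) F) : IsCompact F :=
  hF.isCompact (isCompact_logVoronoi A q)

/-! ### Complementary vertices and projection points. -/

variable [NeZero d] {A : Matrix (Fin d) (Fin n) ℕ} {ω : Fin n → ℝ}

theorem IsLocalMaximizer.isComplementaryVertex (hA : ∀ j, A 0 j = 1) (hω : ∀ i, 0 < ω i)
    {p q : Fin n → ℝ} (hp : IsLocalMaximizer (toricModel ω A) p)
    (hq : IsMLE (toricModel ω A) p q) : IsComplementaryVertex A q p := by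
  have := nonempty_of_mem_stdSimplex hp.1
  have hpq := hq.mem_logVoronoi hA hω hp.1
  have hqs := toricModel_subset_stdSimplex hω A hq.1
  have hF := isExposed_disjoint_support A q p
  refine ⟨_, hp.mem_extremePoints hA hω hq.1 hpq, hF, Set.Subset.antisymm ?_ ?_⟩
  · refine Set.iUnion₂_subset fun w hw i hi => ?_
    have hw' := extremePoints_subset hw
    exact ⟨support_subset_of_mem_logVoronoi hA hω hq.1 hw'.1 hi, fun h => hi (hw'.2 i h)⟩
  · by_cases hne : p = q
    · simp [hne]
    · obtain ⟨u, hu, -, hsu⟩ := exists_residual hqs hpq hne (hp.eq_div_sum hA hω hq.1 hpq)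
      rw [← hsu]
      refine support_subset_faceSupport (isCompact_of_isExposed hF)
        (hF.convex (convex_logVoronoi A q)) ⟨hu, fun i hi => ?_⟩
      by_contra h
      have : i ∈ Function.support u := h
      rw [hsu] at this
      exact this.2 hi

theorem IsComplementaryPair.isProjectionPoint_iff (hA : ∀ j, A 0 j = 1) (hω : ∀ i, 0 < ω i)
    {q v : Fin n → ℝ} {F : Set (Fin n → ℝ)} (hq : q ∈ toricModel ω A)
    (h : IsComplementaryPair A q v F) (hne : v ≠ q) :
    IsProjectionPoint (toricModel ω A) v ↔
      ((line[ℝ, v, q] : Set (Fin n → ℝ)) ∩ intrinsicInterior ℝ F).Nonempty := by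
  obtain ⟨hv, hF, hsF⟩ := h
  have hv := extremePoints_subset hv
  have := nonempty_of_mem_stdSimplex hv.1
  have hqs := toricModel_subset_stdSimplex hω A hq
  have hvq := support_subset_of_mem_logVoronoi hA hω hq hv
  have hFc := isCompact_of_isExposed hF
  have hFconv := hF.convex (convex_logVoronoi A q)
  constructor
  · rintro ⟨-, r, hr, hproj⟩
    -- Uniqueness identifies the MLE in the definition of projection point with `q`.
    obtain rfl := hr.eq_of_mem_logVoronoi hA hω hq hv
    obtain ⟨u, hu, hline, hsu⟩ := exists_residual hqs hv hne hproj
    have hFne : F.Nonempty := by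
      by_contra hemp
      rw [Set.not_nonempty_iff_eq_empty] at hemp
      have h0 : Function.support u = ∅ := by
        rw [hsu, ← hsF, hemp]
        simp [faceSupport]
      rw [Function.support_eq_empty_iff] at h0
      have h1 := hu.1.2
      simp [h0] at h1
    obtain ⟨w, hw, hsw⟩ := exists_mem_support_eq_faceSupport hFc hFconv hFne
      fun x hx => (hF.subset hx).1.1
    have huF := mem_of_support_subset hF hw hu (by rw [hsu, hsw, hsF])
    refine ⟨u, hline, mem_intrinsicInterior_of_support_eq hF huF fun x hx => ?_⟩
    rw [hsu, ← hsF]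
    exact support_subset_faceSupport hFc hFconv hx
  · rintro ⟨u, hline, hu⟩
    have huF := intrinsicInterior_subset hu
    have hsu := support_subset_faceSupport hFc hFconv huF
    rw [hsF] at hsu
    refine ⟨hv.1, q, isMLE_of_mem_logVoronoi hA hω hq hv, ?_⟩
    obtain ⟨t, rfl⟩ := mem_affineSpan_pair_iff_exists_lineMap_eq.1 hline
    -- A point of `F` vanishes on `supp v`; this direction needs only membership in `F`.
    have hzero : ∀ i, v i ≠ 0 → t * q i = (t - 1) * v i := by
      intro i hi
      have h0 : (AffineMap.lineMap v q t : Fin n → ℝ) i = 0 := by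
        by_contra hne'
        exact (hsu hne').2 hi
      simp only [AffineMap.lineMap_apply, vsub_eq_sub, vadd_eq_add, Pi.add_apply, Pi.smul_apply,
        Pi.sub_apply, smul_eq_mul] at h0
      linarith
    have ht : t ≠ 0 := by
      rintro rfl
      have : v = 0 := by
        funext i
        by_contra hi
        have := hzero i hi
        simp at this
        exact hi this
      have h1 := hv.1.2
      simp [this] at h1
    have hqv : ∀ i, v i ≠ 0 → q i = (t - 1) / t * v i := by
      intro i hi
      have := hzero i hi
      field_simp
      linarith
    -- Since `v` has total mass one, the proportionality factor is the mass of `q` on `supp v`.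
    have hsum : ∑ j with v j ≠ 0, q j = (t - 1) / t := by
      rw [Finset.sum_congr rfl fun j hj => hqv j (Finset.mem_filter.1 hj).2, ← Finset.mul_sum,
        Finset.sum_filter_ne_zero, hv.1.2, mul_one]
    intro i
    split_ifs with hi
    · have hc : (t - 1) / t ≠ 0 := by
        intro h0
        exact hvq hi (by rw [hqv i hi, h0, zero_mul])
      rw [hsum, hqv i hi, mul_div_cancel_left₀ _ hc]
    · simpa using hi

end ToricDivergence

theorem theorem3p3 {d n : ℕ} [NeZero d] (A : Matrix (Fin d) (Fin n) ℕ)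
    (hA : ∀ j, A 0 j = 1) (ω : Fin n → ℝ) (hω : ∀ i, 0 < ω i) :
    (∀ p : Fin n → ℝ, ToricDivergence.IsLocalMaximizer (ToricDivergence.toricModel ω A) p →
      ToricDivergence.IsProjectionPoint (ToricDivergence.toricModel ω A) p) ∧
    (∀ p : Fin n → ℝ, ToricDivergence.IsLocalMaximizer (ToricDivergence.toricModel ω A) p →
      ∀ q : Fin n → ℝ, ToricDivergence.IsMLE (ToricDivergence.toricModel ω A) p q →
        ToricDivergence.IsComplementaryVertex A q p) ∧
    (∀ q ∈ ToricDivergence.toricModel ω A, ∀ (v : Fin n → ℝ) (F : Set (Fin n → ℝ)),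
      ToricDivergence.IsComplementaryPair A q v F → v ≠ q →
        (ToricDivergence.IsProjectionPoint (ToricDivergence.toricModel ω A) v ↔
          ((line[ℝ, v, q] : Set (Fin n → ℝ)) ∩ intrinsicInterior ℝ F).Nonempty)) := by
  exact ⟨fun p hp => hp.isProjectionPoint hA hω, fun p hp q hq => hp.isComplementaryVertex hA hω hq,
    fun q hq v F h hne => h.isProjectionPoint_iff hA hω hq hne⟩
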